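/- Let $\omega_1$ be the first uncountable ordinal and let $c_{00}(\omega_1)$ be the space of finitely supported functions $\omega_1\to\mathbb R$, with unit vectors $e_\gamma$ (written $e_\gamma^*$ when regarded as functionals). Fix the following data. * Strictly increasing sequences $(m_j)_{j\ge 1}$, $(n_j)_{j\ge1}$ of positive integers with $m_1\ge 2$. * A function $\varrho:[\omega_1]^2\to\mathbb N$ such that, for all $\alpha<\beta<\gamma<\omega_1$, $\varrho(\alpha,\gamma)\le\max\{\varrho(\alpha,\beta),\varrho(\beta,\gamma)\}$ and $\varrho(\alpha,\beta)\le\max\{\varrho(\alpha,\gamma),\varrho(\beta,\gamma)\}$, and such that $\{\alpha<\beta:\varrho(\alpha,\beta)\le k\}$ is finite for all $\beta<\omega_1$ and $k\in\mathbb N$. Put $\varrho(\alpha,\alpha)=0$. * A coding $\sigma$: let $\mathcal Q$ be the set of sequences $(\phi_1,w_1,p_1,\dots,\phi_d,w_d,p_d)$, $d\ge1$, where $\phi_1<\dots<\phi_d$ are nonzero finitely supported vectors on $\mathbb N$ with rational coordinates and successive supports and $(w_i)$, $(p_i)$ are strictly increasing sequences of natural numbers. Then $\sigma:\mathcal Q\to\{2j: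 j \text{ odd}\}$ is one-to-one and $\sigma(\phi_1,w_1,p_1,\dots,\phi_d,w_d,p_d)>\max\{p_d^2,1/\varepsilon^2,\max\operatorname{supp}\phi_d\}$, where $\varepsilon$ is the least absolute value of a nonzero coordinate of the $\phi_k$. A finite *block sequence* is a sequence of nonzero vectors of $c_{00}(\omega_1)$ with $\max\operatorname{supp}\phi_i<\min\operatorname{supp}\phi_{i+1}$. It is *separated* if $\varrho(\alpha,\beta)\ge|\bigcup_k\operatorname{supp}\phi_k|$ whenever $i\ne j$, $\alpha\in\operatorname{supp}\phi_i$, $\beta\in\operatorname{supp}\phi_j$. Let $\mathcal Q(\omega_1)$ be the set of sequences $s=(\phi_1,w_1,p_1,\dots,\phi_d,w_d,p_d)$, $d\ge 1$, where $(\phi_i)$ is a block sequence in $c_{00}(\omega_1)$ with rational coordinates, $(w_i)$ and $(p_i)$ are strictly increasing sequences of natural numbers, and $p_i\ge\varrho(\alpha,\beta)$ for all $\alpha,\beta\in\bigcup_{k\le i}\operatorname{supp}\phi_k$ and all $i\le d$. For such $s$ let $G_s$ be the finite set of all $\alpha$ with $\alpha\le\beta$ and $\varrho(\alpha,\beta)\le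 p_d$ for some $\beta\in\bigcup_k\operatorname{supp}\phi_k$, and let $\sigma_\varrho(s)$ be the value of $\sigma$ at the sequence obtained from $s$ by transporting each $\phi_k$ by the increasing bijection $G_s\to\{1,\dots,|G_s|\}$. Let $K$ be the smallest subset of $c_{00}(\omega_1)$ such that: 1. $K$ contains all $e^*_\gamma$, $\gamma<\omega_1$, is symmetric, and is closed under restriction to intervals of $\omega_1$; 2. $\frac1{m_{2j}}\sum_{i=1}^d\phi_i\in K$ for all $j\ge 1$ and all separated block sequences $(\phi_i)_{i=1}^d$ in $K$ with $d\le n_{2j}$ (such a functional is said to have *weight* $m_{2j}$); 3. $\frac1{m_{2j+1}}\sum_{i=1}^d\phi_i\in K$ for all $j\ge1$ and all separated $(2j+1)$-special sequences $(\phi_i)_{i=1}^d$ in $K$ with $d\le n_{2j+1}$; 4. $K$ is closed under convex combinations with rational coefficients. Here a block sequence $(\phi_i)_{i=1}^d$ in $K$ is *$(2j+1)$-special* if there are integers $l_1,\dots,l_d\ge 1$ and $p_1,\dots,p_d\ge 0$ such that $\phi_i$ has weight $m_{2l_i}$ for all $i$, $l_1$ is even, $m_{2l_1}>n_{2j+1}^2$,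 and, for $1\le i<d$, the sequence $s_i=(\phi_1,m_{2l_1},p_1,\dots,\phi_i,m_{2l_i},p_i)$ belongs to $\mathcal Q(\omega_1)$ and $2l_{i+1}=\sigma_\varrho(s_i)$. Let $\mathfrak X$ be the completion of $c_{00}(\omega_1)$ under the norm $\|x\|=\sup\{\sum_\alpha\phi(\alpha)x(\alpha):\phi\in K\}$. **Theorem.** $\mathfrak X$ is $c_0$-saturated: every closed infinite-dimensional subspace of $\mathfrak X$ contains a subspace isomorphic to $c_0$. -/

import Mathlib

open scoped ZeroAtInfty BigOperators

set_option linter.unusedSectionVars false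

noncomputable section

namespace C0Sat

/-! ### The index set, block sequences and separation -/

/-- The set of countable ordinals, with its well-order of type `ω₁`. -/
abbrev Omega1 : Type := (Ordinal.omega.{0} 1).ToType

/-- A function on unordered pairs of countable ordinals with the three `ϱ`-function properties.
It is written as a symmetric function of two variables, with value `0` on the diagonal. -/
structure IsRhoFunction (ρ : Omega1 → Omega1 → ℕ) : Prop where
  self : ∀ α, ρ α α = 0
  symm : ∀ α β, ρ α β = ρ β α
  left : ∀ α β γ, α < β → β < γ → ρ α γ ≤ max (ρ α β) (ρ β γ)
  right : ∀ α β γ, α < β → β < γ → ρ α β ≤ max (ρ α γ) (ρ β γ)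
  finite : ∀ (β : Omega1) (k : ℕ), {α | α < β ∧ ρ α β ≤ k}.Finite

section General

variable {ι : Type} [LinearOrder ι]

/-- A finite block sequence of nonzero vectors of `c₀₀(ι)`: the supports are successive. -/
def IsBlock {d : ℕ} (f : Fin d → ι →₀ ℝ) : Prop :=
  (∀ i, f i ≠ 0) ∧ ∀ i j, i < j → ∀ α ∈ (f i).support, ∀ β ∈ (f j).support, α < β

/-- The union of the supports of finitely many vectors. -/
def suppUnion {d : ℕ} (f : Fin d → ι →₀ ℝ) : Finset ι :=
  Finset.univ.biUnion fun i => (f i).support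

/-- `s` and `t` are `p`-separated: `min {ρ α β : α ∈ s, β ∈ t} ≥ p`. -/
def PSeparated (ρ : ι → ι → ℕ) (p : ℕ) (s t : Finset ι) : Prop :=
  ∀ α ∈ s, ∀ β ∈ t, p ≤ ρ α β

/-- A finite sequence of vectors is separated if its supports are pairwise `p`-separated, where
`p` is the cardinality of the union of all the supports. -/
def IsSeparated (ρ : ι → ι → ℕ) {d : ℕ} (f : Fin d → ι →₀ ℝ) : Prop :=
  ∀ i j, i ≠ j → PSeparated ρ (suppUnion f).card (f i).support (f j).support

/-! ### The coding -/

/-- One entry `(φ, w, p)` of a coded sequence `(φ₁, w₁, p₁, …, φ_d, w_d, p_d)`. -/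
structure CodeEntry (ι : Type) where
  functional : ι →₀ ℝ
  weight : ℕ
  bound : ℕ

/-- The sequences `(φ₁, w₁, p₁, …, φ_d, w_d, p_d)`, `d ≥ 1`, for which `φ₁ < ⋯ < φ_d` is a block
sequence of vectors with rational coordinates and `(w_i)`, `(p_i)` are strictly increasing. -/
structure IsCodable (s : List (CodeEntry ι)) : Prop where
  nonempty : s ≠ []
  rational : ∀ e ∈ s, ∀ α, ∃ q : ℚ, e.functional α = (q : ℝ)
  block : IsBlock fun i : Fin s.length => (s.get i).functional
  weight : s.Pairwise fun a b => a.weight < b.weight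
  bound : s.Pairwise fun a b => a.bound < b.bound

/-- The union of the supports of the functionals in a coded sequence. -/
def codeSupport (s : List (CodeEntry ι)) : Finset ι :=
  suppUnion fun i : Fin s.length => (s.get i).functional

/-- The last bound `p_d` of a coded sequence (`0` for the empty one). -/
def lastBound (s : List (CodeEntry ι)) : ℕ :=
  (s.getLast?.map CodeEntry.bound).getD 0

/-- The `ϱ`-number `max {ρ α β : α, β ∈ F}` of a finite set. -/
def rhoNumber (ρ : ι → ι → ℕ) (F : Finset ι) : ℕ :=
  (F ×ˢ F).sup fun x => ρ x.1 x.2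

/-- The codable sequences over `ω₁` with `p_i ≥ ϱ-number of ⋃_{k ≤ i} supp φ_k` for all `i`. -/
def IsRhoCodable (ρ : ι → ι → ℕ) (s : List (CodeEntry ι)) : Prop :=
  IsCodable s ∧ ∀ i : Fin s.length,
    rhoNumber ρ (codeSupport (s.take (i + 1))) ≤ (s.get i).bound

/-- The `p`-closure of `F`: all `α` with `α ≤ β` and `ρ α β ≤ p` for some `β ∈ F`. -/
def pClosure (ρ : ι → ι → ℕ) (F : Finset ι) (p : ℕ) : Set ι :=
  {α | ∃ β ∈ F, α ≤ β ∧ ρ α β ≤ p}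

/-- For `α` in a finite set `G`, the number `k` such that `α` is the `k`-th element of `G` (counted
from `1`); on `G` this is the order isomorphism onto `{1, …, |G|}`. -/
def rank (G : Set ι) (α : ι) : ℕ := {β | β ∈ G ∧ β ≤ α}.ncard

/-- Transport of a vector supported by `G` to `{1, …, |G|}`. -/
def collapse (G : Set ι) (f : ι →₀ ℝ) : ℕ →₀ ℝ := f.mapDomain (rank G)

/-- The conditions on the coding function `σ`: on the countable set of codable sequences over the
natural numbers it is one-to-one, it takes values in `{2j : j odd}`, and
`σ(φ₁, w₁, p₁, …, φ_d, w_d, p_d) > max {p_d², 1/ε², max supp φ_d}`, where `ε` is the least absolute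
value of a nonzero coordinate of the `φ_k`. -/
structure IsCoding (σ : List (CodeEntry ℕ) → ℕ) : Prop where
  injOn : Set.InjOn σ {s | IsCodable s}
  values : ∀ s, IsCodable s → ∃ j, Odd j ∧ σ s = 2 * j
  bound : ∀ s, IsCodable s → (lastBound s) ^ 2 < σ s
  coord : ∀ s, IsCodable s → ∀ e ∈ s, ∀ a ∈ e.functional.support,
    1 / (e.functional a) ^ 2 < (σ s : ℝ)
  support : ∀ s, IsCodable s → ∀ a ∈ codeSupport s, a < σ s

/-- The coding `σ_ϱ` of sequences over `ω₁`: collapse the `p_d`-closure of the union of the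
supports onto an initial segment of the positive integers, and apply `σ`. -/
def sigmaRho (ρ : ι → ι → ℕ) (σ : List (CodeEntry ℕ) → ℕ) (s : List (CodeEntry ι)) : ℕ :=
  σ (s.map fun e =>
    ⟨collapse (pClosure ρ (codeSupport s) (lastBound s)) e.functional, e.weight, e.bound⟩)

/-! ### The norming set -/

/-- `φ = (1/m_j) ∑_{i<d} f_i` for a separated block sequence `(f_i)_{i<d}` in `S` of length
`d ≤ n_j`. -/
def IsCombination (m n : ℕ → ℕ) (ρ : ι → ι → ℕ) (S : Set (ι →₀ ℝ)) (j : ℕ) (φ : ι →₀ ℝ) : Prop :=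
  ∃ (d : ℕ) (f : Fin d → ι →₀ ℝ), d ≤ n j ∧ IsBlock f ∧ IsSeparated ρ f ∧ (∀ i, f i ∈ S) ∧
    φ = (1 / (m j : ℝ)) • ∑ i, f i

/-- `(φ_i)_{i<d}` is a `(2j+1)`-special sequence of elements of `S`: it is a block sequence in `S`,
`φ_i` has weight `m_{2 l_i}`, where `l_0` is even and `m_{2 l_0} > n_{2j+1}²`, and there are
natural numbers `p_i` such that for each `0 < i < d` the sequence
`(φ_0, m_{2 l_0}, p_0, …, φ_{i-1}, m_{2 l_{i-1}}, p_{i-1})` is in the domain of `σ_ϱ` and has the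
code `2 l_i`. -/
def IsSpecial (m n : ℕ → ℕ) (ρ : ι → ι → ℕ) (σ : List (CodeEntry ℕ) → ℕ) (S : Set (ι →₀ ℝ))
    (j : ℕ) {d : ℕ} (φ : Fin d → ι →₀ ℝ) : Prop :=
  IsBlock φ ∧ (∀ i, φ i ∈ S) ∧
  ∃ (l p : Fin d → ℕ),
    (∀ i, 1 ≤ l i ∧ IsCombination m n ρ S (2 * l i) (φ i)) ∧
    (∀ i : Fin d, (i : ℕ) = 0 → Even (l i) ∧ (n (2 * j + 1)) ^ 2 < m (2 * l i)) ∧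
    ∀ i : Fin d, 0 < (i : ℕ) →
      let s := (List.ofFn fun k => (⟨φ k, m (2 * l k), p k⟩ : CodeEntry ι)).take i
      IsRhoCodable ρ s ∧ 2 * l i = sigmaRho ρ σ s

open Classical in
/-- The closure conditions (i)–(iv) in the definition of the norming set. -/
structure IsNormingClosed (m n : ℕ → ℕ) (ρ : ι → ι → ℕ) (σ : List (CodeEntry ℕ) → ℕ)
    (S : Set (ι →₀ ℝ)) : Prop where
  basis : ∀ γ, Finsupp.single γ 1 ∈ S
  neg : ∀ φ ∈ S, -φ ∈ S
  restrict : ∀ φ ∈ S, ∀ I : Set ι, I.OrdConnected → φ.filter (· ∈ I) ∈ S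
  even : ∀ j, 1 ≤ j → ∀ φ, IsCombination m n ρ S (2 * j) φ → φ ∈ S
  special : ∀ j, 1 ≤ j → ∀ (d : ℕ) (f : Fin d → ι →₀ ℝ), d ≤ n (2 * j + 1) →
    IsSpecial m n ρ σ S j f → IsSeparated ρ f →
    (1 / (m (2 * j + 1) : ℝ)) • ∑ i, f i ∈ S
  convex : ∀ (k : ℕ) (f : Fin k → ι →₀ ℝ) (r : Fin k → ℚ), (∀ i, f i ∈ S) → (∀ i, 0 ≤ r i) →
    ∑ i, r i = 1 → ∑ i, (r i : ℝ) • f i ∈ S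

/-- The norming set `K`: the smallest set with the closure conditions. -/
def normingSet (m n : ℕ → ℕ) (ρ : ι → ι → ℕ) (σ : List (CodeEntry ℕ) → ℕ) : Set (ι →₀ ℝ) :=
  ⋂₀ {S | IsNormingClosed m n ρ σ S}

/-- The pairing `φ(x) = ∑_α φ(α) x(α)`. -/
def pairing (φ x : ι →₀ ℝ) : ℝ := x.sum fun α a => φ α * a

/-! ### Facts needed to see that the supremum over `K` is a norm -/

theorem IsBlock.abs_sum_le {d : ℕ} {f : Fin d → ι →₀ ℝ} (hf : IsBlock f)
    (h : ∀ i α, |f i α| ≤ 1) (α : ι) : |(∑ i, f i) α| ≤ 1 := by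
  rw [Finsupp.finsetSum_apply]
  by_cases H : ∃ i, f i α ≠ 0
  · obtain ⟨i, hi⟩ := H
    rw [Finset.sum_eq_single i]
    · exact h i α
    · intro j _ hji
      by_contra hj
      have hi' : α ∈ (f i).support := Finsupp.mem_support_iff.2 hi
      have hj' : α ∈ (f j).support := Finsupp.mem_support_iff.2 hj
      rcases lt_or_gt_of_ne hji with hlt | hlt
      · exact lt_irrefl _ (hf.2 j i hlt α hj' α hi')
      · exact lt_irrefl _ (hf.2 i j hlt α hi' α hj')
    · simp
  · push Not at H
    simp [H]

theorem abs_smul_le_one (k : ℕ) {φ : ι →₀ ℝ} {α : ι} (h : |φ α| ≤ 1) :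
    |((1 / (k : ℝ)) • φ) α| ≤ 1 := by
  rw [Finsupp.smul_apply, smul_eq_mul, abs_mul]
  have h1 : |1 / (k : ℝ)| ≤ 1 := by
    rcases Nat.eq_zero_or_pos k with rfl | hk
    · simp
    · have : (1 : ℝ) ≤ k := by exact_mod_cast hk
      rw [abs_of_nonneg (by positivity)]
      exact (div_le_one (by positivity)).2 this
  exact mul_le_one₀ h1 (abs_nonneg _) h

theorem isNormingClosed_unit (m n : ℕ → ℕ) (ρ : ι → ι → ℕ) (σ : List (CodeEntry ℕ) → ℕ) :
    IsNormingClosed m n ρ σ {φ : ι →₀ ℝ | ∀ α, |φ α| ≤ 1} where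
  basis γ α := by
    classical
    rw [Finsupp.single_apply]
    split_ifs <;> simp
  neg φ h α := by simpa using h α
  restrict φ h I _ α := by
    classical
    rw [Finsupp.filter_apply]
    split_ifs
    · exact h α
    · simp
  even := by
    rintro j _ φ ⟨d, f, _, hb, _, hS, rfl⟩ α
    exact abs_smul_le_one _ (hb.abs_sum_le hS α)
  special := by
    rintro j _ d f _ hsp _ α
    exact abs_smul_le_one _ (hsp.1.abs_sum_le hsp.2.1 α)
  convex := by
    intro k f r hf hr hsum α
    rw [Finsupp.finsetSum_apply]
    have hsum' : ∑ i, (r i : ℝ) = 1 := by exact_mod_cast hsum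
    rw [← hsum']
    refine (Finset.abs_sum_le_sum_abs _ _).trans (Finset.sum_le_sum fun i _ => ?_)
    have h0 : (0 : ℝ) ≤ r i := by exact_mod_cast hr i
    rw [Finsupp.smul_apply, smul_eq_mul, abs_mul, abs_of_nonneg h0]
    exact mul_le_of_le_one_right h0 (hf i α)

theorem abs_le_one_of_mem {m n : ℕ → ℕ} {ρ : ι → ι → ℕ} {σ : List (CodeEntry ℕ) → ℕ}
    {φ : ι →₀ ℝ} (h : φ ∈ normingSet m n ρ σ) (α : ι) : |φ α| ≤ 1 :=
  Set.mem_sInter.1 h _ (isNormingClosed_unit m n ρ σ) α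

theorem single_mem (m n : ℕ → ℕ) (ρ : ι → ι → ℕ) (σ : List (CodeEntry ℕ) → ℕ) (γ : ι) :
    Finsupp.single γ 1 ∈ normingSet m n ρ σ :=
  Set.mem_sInter.2 fun _ hS => hS.basis γ

theorem neg_mem {m n : ℕ → ℕ} {ρ : ι → ι → ℕ} {σ : List (CodeEntry ℕ) → ℕ}
    {φ : ι →₀ ℝ} (h : φ ∈ normingSet m n ρ σ) : -φ ∈ normingSet m n ρ σ :=
  Set.mem_sInter.2 fun S hS => hS.neg φ (Set.mem_sInter.1 h S hS)

theorem pairing_add (φ x y : ι →₀ ℝ) : pairing φ (x + y) = pairing φ x + pairing φ y :=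
  Finsupp.sum_add_index' (by simp) (by intros; ring)

theorem pairing_smul (φ : ι →₀ ℝ) (c : ℝ) (x : ι →₀ ℝ) :
    pairing φ (c • x) = c * pairing φ x := by
  unfold pairing
  rw [Finsupp.sum_smul_index' (by simp), Finsupp.mul_sum]
  exact Finsupp.sum_congr fun a _ => by simp [mul_left_comm]

theorem pairing_neg_left (φ x : ι →₀ ℝ) : pairing (-φ) x = -pairing φ x := by
  simp [pairing, Finsupp.sum]

theorem pairing_single (γ : ι) (x : ι →₀ ℝ) : pairing (Finsupp.single γ 1) x = x γ := by
  classical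
  unfold pairing Finsupp.sum
  simp only [Finsupp.single_apply, ite_mul, one_mul, zero_mul, Finset.sum_ite_eq]
  split_ifs with h
  · rfl
  · exact (Finsupp.notMem_support_iff.1 h).symm

end General

/-! ### The space -/

section Space

/-- The vector space `c₀₀(ω₁)`, which will carry the norm induced by `K`. -/
def PreSpace (_m _n : ℕ → ℕ) (_ρ : Omega1 → Omega1 → ℕ) (_σ : List (CodeEntry ℕ) → ℕ) : Type :=
  Omega1 →₀ ℝ

variable (m n : ℕ → ℕ) (ρ : Omega1 → Omega1 → ℕ) (σ : List (CodeEntry ℕ) → ℕ)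

instance : AddCommGroup (PreSpace m n ρ σ) := inferInstanceAs (AddCommGroup (Omega1 →₀ ℝ))

instance : Module ℝ (PreSpace m n ρ σ) := inferInstanceAs (Module ℝ (Omega1 →₀ ℝ))

variable {m n ρ σ}

/-- The underlying finitely supported function of an element of `PreSpace`. -/
def toC00 : PreSpace m n ρ σ ≃ₗ[ℝ] (Omega1 →₀ ℝ) := LinearEquiv.refl ℝ (Omega1 →₀ ℝ)

/-- The norm `‖x‖ = sup {φ(x) : φ ∈ K}`. -/
instance : Norm (PreSpace m n ρ σ) where
  norm x := sSup ((fun φ => pairing φ (toC00 x)) '' normingSet m n ρ σ)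

theorem norm_def (x : PreSpace m n ρ σ) :
    ‖x‖ = sSup ((fun φ => pairing φ (toC00 x)) '' normingSet m n ρ σ) := rfl

theorem bddAbove_pairing (x : PreSpace m n ρ σ) :
    BddAbove ((fun φ => pairing φ (toC00 x)) '' normingSet m n ρ σ) := by
  refine ⟨(toC00 x).sum fun _ a => |a|, ?_⟩
  rintro _ ⟨φ, hφ, rfl⟩
  refine Finset.sum_le_sum fun α _ => (le_abs_self _).trans ?_
  rw [abs_mul]
  exact mul_le_of_le_one_left (abs_nonneg _) (abs_le_one_of_mem hφ α)

theorem pairing_le_norm (x : PreSpace m n ρ σ) {φ : Omega1 →₀ ℝ} (h : φ ∈ normingSet m n ρ σ) :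
    pairing φ (toC00 x) ≤ ‖x‖ :=
  le_csSup (bddAbove_pairing x) ⟨φ, h, rfl⟩

theorem exists_index : Nonempty Omega1 :=
  Ordinal.nonempty_toType_iff.2 (Ordinal.omega_pos 1).ne'

theorem norm_le_of {x : PreSpace m n ρ σ} {C : ℝ}
    (h : ∀ φ ∈ normingSet m n ρ σ, pairing φ (toC00 x) ≤ C) : ‖x‖ ≤ C := by
  obtain ⟨γ⟩ := exists_index
  refine csSup_le ⟨_, _, single_mem m n ρ σ γ, rfl⟩ ?_
  rintro _ ⟨φ, hφ, rfl⟩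
  exact h φ hφ

theorem abs_pairing_le_norm (x : PreSpace m n ρ σ) {φ : Omega1 →₀ ℝ}
    (h : φ ∈ normingSet m n ρ σ) : |pairing φ (toC00 x)| ≤ ‖x‖ := by
  refine abs_le'.2 ⟨pairing_le_norm x h, ?_⟩
  rw [← pairing_neg_left]
  exact pairing_le_norm x (neg_mem h)

theorem abs_apply_le_norm (x : PreSpace m n ρ σ) (γ : Omega1) : |toC00 x γ| ≤ ‖x‖ := by
  have := abs_pairing_le_norm x (single_mem m n ρ σ γ)
  rwa [pairing_single] at this

theorem norm_smul_le_pre (c : ℝ) (x : PreSpace m n ρ σ) : ‖c • x‖ ≤ |c| * ‖x‖ := by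
  refine norm_le_of fun φ hφ => ?_
  rw [map_smul, pairing_smul]
  refine (le_abs_self _).trans ?_
  rw [abs_mul]
  exact mul_le_mul_of_nonneg_left (abs_pairing_le_norm x hφ) (abs_nonneg c)

theorem norm_nonneg_pre (x : PreSpace m n ρ σ) : 0 ≤ ‖x‖ := by
  obtain ⟨γ⟩ := exists_index
  exact (abs_nonneg _).trans (abs_apply_le_norm x γ)

theorem core (m n : ℕ → ℕ) (ρ : Omega1 → Omega1 → ℕ) (σ : List (CodeEntry ℕ) → ℕ) :
    NormedSpace.Core ℝ (PreSpace m n ρ σ) where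
  norm_nonneg := norm_nonneg_pre
  norm_smul c x := by
    rw [Real.norm_eq_abs]
    refine le_antisymm (norm_smul_le_pre c x) ?_
    rcases eq_or_ne c 0 with rfl | hc
    · simpa using norm_nonneg_pre ((0 : ℝ) • x)
    · have h := norm_smul_le_pre c⁻¹ (c • x)
      rw [smul_smul, inv_mul_cancel₀ hc, one_smul, abs_inv] at h
      have hc' : 0 < |c| := abs_pos.2 hc
      calc |c| * ‖x‖ ≤ |c| * (|c|⁻¹ * ‖c • x‖) := mul_le_mul_of_nonneg_left h hc'.le
        _ = ‖c • x‖ := by field_simp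
  norm_triangle x y := by
    refine norm_le_of fun φ hφ => ?_
    rw [map_add, pairing_add]
    exact add_le_add (pairing_le_norm x hφ) (pairing_le_norm y hφ)
  norm_eq_zero_iff x := by
    constructor
    · intro h
      refine toC00.map_eq_zero_iff.1 (Finsupp.ext fun γ => ?_)
      have := abs_apply_le_norm x γ
      rw [h] at this
      exact abs_nonpos_iff.1 this
    · rintro rfl
      refine le_antisymm (norm_le_of fun φ _ => ?_) (norm_nonneg_pre _)
      simp [pairing]

variable (m n ρ σ)

instance : NormedAddCommGroup (PreSpace m n ρ σ) := NormedAddCommGroup.ofCore (core m n ρ σ)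

instance : NormedSpace ℝ (PreSpace m n ρ σ) := NormedSpace.ofCore (core m n ρ σ)

/-- The Banach space `𝔛`: the completion of `c₀₀(ω₁)` under the norm induced by `K`. -/
abbrev SpaceX : Type := UniformSpace.Completion (PreSpace m n ρ σ)

end Space

/-- `E` is `c₀`-saturated: every closed infinite-dimensional subspace of `E` contains a subspace
isomorphic to `c₀`. -/
def IsC0Saturated (E : Type) [NormedAddCommGroup E] [NormedSpace ℝ E] : Prop :=
  ∀ Y : Submodule ℝ E, IsClosed (Y : Set E) → ¬ FiniteDimensional ℝ Y →
    ∃ Z : Submodule ℝ E, Z ≤ Y ∧ Nonempty (C₀(ℕ, ℝ) ≃L[ℝ] Z)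

end C0Sat

end

/-!
The proof rests on two features of the norming set `K`: each of its averages carries a factor
`1 / m_j ≤ 1 / 2`, and each of them, special or not, is formed from a *separated* sequence.

Let `x_0, x_1, …` be vectors of `c₀₀(ω₁)` of norm at most `2`, and suppose that `‖x_k‖_∞` is at most
`2⁻ᵏ` divided by one plus the `ϱ`-number of `supp x_0 ∪ ⋯ ∪ supp x_{k-1}`. Then `∑ a_k x_k` has norm
at most `8` if `|a_k| ≤ 1`. To see this for an average `φ = (1 / M) ∑ f_i` of a separated sequence,
let `k` be least such that two of the `f_i` meet `supp x_0 ∪ ⋯ ∪ supp x_k`. By separation the support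
of `φ` has at most as many elements as the `ϱ`-number of this set, so `∑_{l > k} |φ(x_l)| ≤ 2`;
moreover `|φ(x_k)| ≤ 2`; and on `x_0, …, x_{k-1}` a single `f_i` acts, which by induction contributes
at most `8 / M ≤ 4`. This is `mem_boundedOn_of_isSeparated`, and the induction over `K` is
`isNormingClosed_boundedOn`.

Let `Y` be a closed infinite-dimensional subspace. Either the norm is equivalent to the supremum of
the coordinates on the elements of `Y` annihilated by some finite set of functionals, or the common
kernel of any finitely many functionals contains unit vectors of `Y` with arbitrarily small
coordinates. In the first case a gliding hump in `c₀(ω₁)` gives unit vectors of `Y` with an upper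
`c₀`-estimate (`exists_equiv_c0_of_norm_le_coord`); in the second one, small perturbations of a
sequence `(x_k)` as above do (`exists_equiv_c0_of_small_coord`). In both cases the vectors can be
taken in the kernel of any finitely many functionals, so Mazur's construction
(`exists_seq_abs_le_norm_sum`) makes the sequence basic, which provides the lower `c₀`-estimate.
-/

noncomputable section

namespace C0Sat

/-! ### Copies of `c₀` in Banach spaces -/

section Banach

variable {X : Type*} [NormedAddCommGroup X] [NormedSpace ℝ X]

/-- The common kernel of finitely many functionals meets an infinite-dimensional subspace in a
unit vector. -/
theorem exists_unit_vector_mem_ker {Y : Submodule ℝ X} (hY : ¬ FiniteDimensional ℝ Y)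
    (Ψ : Finset (StrongDual ℝ X)) : ∃ y ∈ Y, ‖y‖ = 1 ∧ ∀ f ∈ Ψ, f y = 0 := by
  let T : Y →ₗ[ℝ] (Ψ → ℝ) := LinearMap.pi fun f => (f : StrongDual ℝ X).toLinearMap ∘ₗ Y.subtype
  have hT : ¬ Function.Injective T := fun h => hY (FiniteDimensional.of_injective T h)
  rw [← LinearMap.ker_eq_bot, Submodule.eq_bot_iff] at hT
  push Not at hT
  obtain ⟨z, hz, hz0⟩ := hT
  have hz0' : (z : X) ≠ 0 := by simpa using hz0
  have hn : ‖(z : X)‖ ≠ 0 := norm_ne_zero_iff.2 hz0'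
  refine ⟨‖(z : X)‖⁻¹ • (z : X), Y.smul_mem _ z.2, ?_, fun f hf => ?_⟩
  · rw [norm_smul, norm_inv, norm_norm, inv_mul_cancel₀ hn]
  · have : f (z : X) = 0 := congrFun (LinearMap.mem_ker.1 hz) ⟨f, hf⟩
    rw [map_smul, this, smul_zero]

/-- Mazur's lemma: on a finite-dimensional subspace the norm is attained, up to the factor `2`, by
finitely many functionals, so the subspace is almost orthogonal to their common kernel. -/
theorem exists_finset_dual_norm_le (s : Finset X) : ∃ Ψ : Finset (StrongDual ℝ X),
    ∀ z ∈ Submodule.span ℝ (s : Set X), ∀ w, (∀ f ∈ Ψ, f w = 0) → ‖z‖ ≤ 2 * ‖z + w‖ := by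
  classical
  let E := Submodule.span ℝ (s : Set X)
  have : FiniteDimensional ℝ E := FiniteDimensional.span_finset ℝ s
  have : ProperSpace E := FiniteDimensional.proper_real E
  choose g hg1 hg2 using fun x : E => exists_dual_vector'' ℝ (x : X)
  obtain ⟨t, -, ht⟩ := (isCompact_sphere (0 : E) 1).elim_nhds_subcover
    (fun x => {z : E | 1 / 2 < g x (z : X)}) (by
      intro x hx
      refine IsOpen.mem_nhds ?_ ?_
      · exact isOpen_lt continuous_const ((g x).continuous.comp continuous_subtype_val)
      · have hx1 : ‖(x : X)‖ = 1 := by simpa using hx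
        have : g x (x : X) = 1 := by rw [hg2, hx1]; rfl
        simp only [Set.mem_ofPred_eq, this]
        norm_num)
  refine ⟨t.image g, fun z hz w hw => ?_⟩
  rcases eq_or_ne z 0 with rfl | hz0
  · simp
  have hn : 0 < ‖z‖ := norm_pos_iff.2 hz0
  have hu : (⟨‖z‖⁻¹ • z, E.smul_mem _ hz⟩ : E) ∈ Metric.sphere (0 : E) 1 := by
    rw [mem_sphere_zero_iff_norm]
    change ‖‖z‖⁻¹ • z‖ = 1
    rw [norm_smul, norm_inv, norm_norm, inv_mul_cancel₀ hn.ne']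
  obtain ⟨x, hx, hxz⟩ := Set.mem_iUnion₂.1 (ht hu)
  have h1 : 1 / 2 < ‖z‖⁻¹ * g x z := by simpa using hxz
  have h2 : g x z = g x (z + w) := by
    rw [map_add, hw _ (Finset.mem_image_of_mem g hx), add_zero]
  have h3 : g x (z + w) ≤ ‖z + w‖ :=
    (le_abs_self _).trans (((g x).le_of_opNorm_le (hg1 x) _).trans_eq (one_mul _))
  rw [inv_mul_eq_div, lt_div_iff₀ hn] at h1
  linarith

/-- Recursive choice, where the condition on each term may depend on all the earlier ones. -/
theorem exists_seq_forall_initial {α : Type*} (Q : ∀ n, (Fin n → α) → α → Prop)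
    (h : ∀ n g, ∃ a, Q n g a) : ∃ f : ℕ → α, ∀ n, Q n (fun i => f i) (f n) := by
  choose F hF using h
  let f : ℕ → α := Nat.strongRec (motive := fun _ => α) fun n ih => F n fun i => ih i i.2
  refine ⟨f, fun n => ?_⟩
  have e : f n = F n fun i => f i := Nat.strongRec_eq _ n
  rw [e]
  exact hF n _

/-- If admissible vectors can be found in the common kernel of any finitely many functionals, then
there is a basic sequence of admissible unit vectors. -/
theorem exists_seq_abs_le_norm_sum {α : Type*} (v : α → X)
    (Q : ∀ n, (Fin n → α) → α → Prop)
    (h : ∀ n g (Ψ : Finset (StrongDual ℝ X)),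
      ∃ a, Q n g a ∧ ‖v a‖ = 1 ∧ ∀ f ∈ Ψ, f (v a) = 0) :
    ∃ u : ℕ → α, (∀ n, Q n (fun i => u i) (u n)) ∧ (∀ n, ‖v (u n)‖ = 1) ∧
      ∀ (a : ℕ → ℝ) (N k : ℕ), k < N → |a k| ≤ 4 * ‖∑ i ∈ Finset.range N, a i • v (u i)‖ := by
  classical
  choose M hM using exists_finset_dual_norm_le (X := X)
  obtain ⟨u, hu⟩ := exists_seq_forall_initial
    (fun n g a => Q n g a ∧ ‖v a‖ = 1 ∧
      ∀ f ∈ (Finset.univ.image fun i : Fin n => v (g i)).powerset.biUnion M, f (v a) = 0)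
    (fun n g => h n g _)
  refine ⟨u, fun n => (hu n).1, fun n => (hu n).2.1, fun a N k hk => ?_⟩
  have key : ∀ j ≤ N, ‖∑ i ∈ Finset.range j, a i • v (u i)‖ ≤
      2 * ‖∑ i ∈ Finset.range N, a i • v (u i)‖ := by
    intro j hj
    rw [← Finset.sum_range_add_sum_Ico _ hj]
    -- The later vectors lie in the kernel of the functionals chosen for the span of the first `j`.
    refine hM ((Finset.range j).image fun i => v (u i)) _ ?_ _ fun f hf => ?_
    · refine Submodule.sum_mem _ fun i hi => Submodule.smul_mem _ _ (Submodule.subset_span ?_)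
      exact Finset.mem_coe.2 (Finset.mem_image_of_mem _ hi)
    · rw [map_sum]
      refine Finset.sum_eq_zero fun l hl => ?_
      rw [map_smul, (hu l).2.2 f, smul_zero]
      refine Finset.mem_biUnion.2 ⟨_, Finset.mem_powerset.2 ?_, hf⟩
      intro x hx
      obtain ⟨i, hi, rfl⟩ := Finset.mem_image.1 hx
      have hil : i < l := (Finset.mem_range.1 hi).trans_le (Finset.mem_Ico.1 hl).1
      exact Finset.mem_image.2 ⟨⟨i, hil⟩, Finset.mem_univ _, rfl⟩
  have h1 := key (k + 1) hk
  have h2 := key k hk.le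
  have h3 : a k • v (u k) = ∑ i ∈ Finset.range (k + 1), a i • v (u i) -
      ∑ i ∈ Finset.range k, a i • v (u i) := by
    rw [Finset.sum_range_succ, add_sub_cancel_left]
  have h4 : |a k| = ‖a k • v (u k)‖ := by rw [norm_smul, (hu k).2.1, mul_one, Real.norm_eq_abs]
  rw [h4, h3]
  exact (norm_sub_le _ _).trans (by linarith)

/-- An upper estimate for initial sums with coefficients in `[-1, 1]` extends to all finite sums. -/
theorem norm_sum_smul_le_of_abs_le {y : ℕ → X} {C : ℝ}
    (hC : ∀ a : ℕ → ℝ, (∀ k, |a k| ≤ 1) → ∀ N, ‖∑ k ∈ Finset.range N, a k • y k‖ ≤ C)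
    (t : Finset ℕ) (a : ℕ → ℝ) {δ : ℝ} (hδ : 0 < δ) (ha : ∀ k ∈ t, |a k| ≤ δ) :
    ‖∑ k ∈ t, a k • y k‖ ≤ C * δ := by
  classical
  obtain ⟨N, hN⟩ := t.exists_nat_subset_range
  have h := hC (fun k => if k ∈ t then a k / δ else 0) (fun k => by
    split_ifs with hk
    · rw [abs_div, abs_of_pos hδ]
      exact (div_le_one hδ).2 (ha k hk)
    · simp) N
  have h' : ∑ k ∈ t, a k • y k =
      δ • ∑ k ∈ Finset.range N, (if k ∈ t then a k / δ else 0) • y k := by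
    rw [Finset.smul_sum, ← Finset.sum_subset hN]
    · refine Finset.sum_congr rfl fun k hk => ?_
      rw [if_pos hk, smul_smul, mul_div_cancel₀ _ hδ.ne']
    · intro k _ hk
      simp [hk]
  rw [h', norm_smul, Real.norm_of_nonneg hδ.le, mul_comm C]
  exact mul_le_mul_of_nonneg_left h hδ.le

/-- A sequence satisfying upper and lower `c₀`-estimates spans an isomorphic copy of `c₀`. -/
theorem exists_submodule_equiv_c0 [CompleteSpace X] {Y : Submodule ℝ X}
    (hY : IsClosed (Y : Set X)) {y : ℕ → X} (hyY : ∀ k, y k ∈ Y) {C D : ℝ}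
    (hC : ∀ a : ℕ → ℝ, (∀ k, |a k| ≤ 1) → ∀ N, ‖∑ k ∈ Finset.range N, a k • y k‖ ≤ C)
    (hD : ∀ (a : ℕ → ℝ) (N k : ℕ), k < N →
      |a k| ≤ D * ‖∑ i ∈ Finset.range N, a i • y i‖) :
    ∃ Z : Submodule ℝ X, Z ≤ Y ∧ Nonempty (C₀(ℕ, ℝ) ≃L[ℝ] Z) := by
  classical
  have hC0 : 0 ≤ C := by simpa using hC (fun _ => 0) (by simp) 0
  have happly : ∀ (a : C₀(ℕ, ℝ)) k, |a k| ≤ ‖a‖ := fun a k => a.toBCF.norm_coe_le_norm k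
  have hsum : ∀ a : C₀(ℕ, ℝ), Summable fun k => a k • y k := by
    intro a
    refine summable_iff_vanishing_norm.2 fun ε hε => ?_
    have hδ : 0 < ε / (2 * (C + 1)) := by positivity
    have hfin : {k : ℕ | ¬ |a k| < ε / (2 * (C + 1))}.Finite := by
      have h0 := a.zero_at_infty'
      rw [Filter.cocompact_eq_cofinite] at h0
      have h1 := (Metric.tendsto_nhds.1 h0) _ hδ
      simpa [Filter.eventually_cofinite] using h1
    refine ⟨hfin.toFinset, fun t ht => ?_⟩
    have hle := norm_sum_smul_le_of_abs_le hC t a hδ fun k hk => by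
      have hk' := Finset.disjoint_left.1 ht hk
      rw [Set.Finite.mem_toFinset, Set.mem_ofPred_eq, not_not] at hk'
      exact hk'.le
    refine hle.trans_lt ?_
    rw [mul_div_assoc', div_lt_iff₀ (by positivity)]
    nlinarith
  have hlim : ∀ a : C₀(ℕ, ℝ), Filter.Tendsto (fun N => ∑ k ∈ Finset.range N, a k • y k)
      Filter.atTop (nhds (∑' k, a k • y k)) := fun a => (hsum a).hasSum.tendsto_sum_nat
  let T : C₀(ℕ, ℝ) →ₗ[ℝ] X :=
    { toFun := fun a => ∑' k, a k • y k
      map_add' := fun a b => by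
        rw [← (hsum a).tsum_add (hsum b)]
        exact tsum_congr fun k => add_smul _ _ _
      map_smul' := fun c a => by
        rw [RingHom.id_apply, ← (hsum a).tsum_const_smul]
        exact tsum_congr fun k => mul_smul _ _ _ }
  have hupper : ∀ a, ‖T a‖ ≤ C * ‖a‖ := by
    intro a
    refine le_of_tendsto (hlim a).norm (Filter.Eventually.of_forall fun N => ?_)
    rcases eq_or_ne a 0 with rfl | ha
    · simp
    · exact norm_sum_smul_le_of_abs_le hC _ a (norm_pos_iff.2 ha) fun k _ => happly a k
  have hlower : ∀ a, ‖a‖ ≤ max D 0 * ‖T a‖ := by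
    intro a
    rw [← ZeroAtInftyContinuousMap.norm_toBCF_eq_norm]
    refine (BoundedContinuousFunction.norm_le (by positivity)).2 fun k => ?_
    refine (ge_of_tendsto ((hlim a).norm.const_mul D) ?_).trans
      (mul_le_mul_of_nonneg_right (le_max_left D 0) (norm_nonneg _))
    filter_upwards [Filter.eventually_gt_atTop k] with N hN
    exact hD a N k hN
  have hinj : Function.Injective T := by
    refine (injective_iff_map_eq_zero T).2 fun a ha => ?_
    have := hlower a
    rw [ha, norm_zero, mul_zero] at this
    exact norm_le_zero_iff.1 this
  refine ⟨LinearMap.range T, ?_, ⟨(LinearEquiv.ofInjective T hinj).toContinuousLinearEquivOfBounds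
    C (max D 0) (fun a => hupper a) fun z => ?_⟩⟩
  · rintro _ ⟨a, rfl⟩
    exact hY.mem_of_tendsto (hlim a) (Filter.Eventually.of_forall fun N =>
      Y.sum_mem fun k _ => Y.smul_mem _ (hyY k))
  · obtain ⟨a, rfl⟩ := (LinearEquiv.ofInjective T hinj).surjective z
    rw [LinearEquiv.symm_apply_apply]
    exact hlower a

end Banach

/-! ### Upper `c₀`-estimates on the norming set -/

section Norming

variable {ι : Type} [LinearOrder ι] {m n : ℕ → ℕ} {ρ : ι → ι → ℕ} {σ : List (CodeEntry ℕ) → ℕ}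

theorem pairing_eq_sum (φ x : ι →₀ ℝ) : pairing φ x = ∑ α ∈ φ.support, φ α * x α := by
  classical
  have h1 : pairing φ x = ∑ α ∈ φ.support ∪ x.support, φ α * x α :=
    Finset.sum_subset Finset.subset_union_right fun α _ h => by
      simp [Finsupp.notMem_support_iff.1 h]
  rw [h1]
  exact (Finset.sum_subset Finset.subset_union_left fun α _ h => by
    rw [Finsupp.notMem_support_iff.1 h, zero_mul]).symm

/-- The pairing as a linear functional of its first argument. -/
def pairingLeft (x : ι →₀ ℝ) : (ι →₀ ℝ) →ₗ[ℝ] ℝ := Finsupp.lsum ℝ fun α => x α • LinearMap.id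

theorem pairingLeft_apply (x φ : ι →₀ ℝ) : pairingLeft x φ = pairing φ x := by
  rw [pairing_eq_sum, pairingLeft, Finsupp.lsum_apply]
  exact Finset.sum_congr rfl fun α _ => mul_comm _ _

theorem pairing_smul_left (c : ℝ) (φ x : ι →₀ ℝ) : pairing (c • φ) x = c * pairing φ x := by
  simp only [← pairingLeft_apply, map_smul, smul_eq_mul]

theorem pairing_sum_left {κ : Type*} (s : Finset κ) (f : κ → ι →₀ ℝ) (x : ι →₀ ℝ) :
    pairing (∑ i ∈ s, f i) x = ∑ i ∈ s, pairing (f i) x := by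
  simp only [← pairingLeft_apply, map_sum]

theorem pairing_sum_right {κ : Type*} (s : Finset κ) (x : κ → ι →₀ ℝ) (φ : ι →₀ ℝ) :
    pairing φ (∑ i ∈ s, x i) = ∑ i ∈ s, pairing φ (x i) := by
  simp only [pairing_eq_sum, Finsupp.finsetSum_apply, Finset.mul_sum]
  exact Finset.sum_comm

theorem abs_pairing_le_of_forall_le {φ x : ι →₀ ℝ} (hφ : ∀ α, |φ α| ≤ 1) {B : ℝ} {F : Finset ι}
    (hF : φ.support ⊆ F) (hB : ∀ α, |x α| ≤ B) : |pairing φ x| ≤ F.card * B := by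
  have hB' : ∀ α ∈ F, 0 ≤ B := fun α _ => (abs_nonneg _).trans (hB α)
  rw [pairing_eq_sum, Finset.sum_subset hF fun α _ h => by
    rw [Finsupp.notMem_support_iff.1 h, zero_mul]]
  refine (Finset.abs_sum_le_sum_abs _ _).trans ?_
  rw [← nsmul_eq_mul]
  refine Finset.sum_le_card_nsmul _ _ _ fun α hα => ?_
  rw [abs_mul]
  exact (mul_le_of_le_one_left (abs_nonneg _) (hφ α)).trans (hB α)

theorem pairing_eq_zero_of_disjoint {φ x : ι →₀ ℝ} (h : Disjoint φ.support x.support) :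
    pairing φ x = 0 := by
  rw [pairing_eq_sum]
  refine Finset.sum_eq_zero fun α hα => ?_
  rw [Finsupp.notMem_support_iff.1 (Finset.disjoint_left.1 h hα), mul_zero]

theorem le_rhoNumber {F : Finset ι} {α β : ι} (hα : α ∈ F) (hβ : β ∈ F) :
    ρ α β ≤ rhoNumber ρ F :=
  Finset.le_sup (f := fun x : ι × ι => ρ x.1 x.2) (Finset.mk_mem_product hα hβ)

theorem rhoNumber_mono {F G : Finset ι} (h : F ⊆ G) : rhoNumber ρ F ≤ rhoNumber ρ G :=
  Finset.sup_mono (Finset.product_subset_product h h)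

theorem IsCombination.mono {S S' : Set (ι →₀ ℝ)} (h : S ⊆ S') {j : ℕ} {φ : ι →₀ ℝ}
    (H : IsCombination m n ρ S j φ) : IsCombination m n ρ S' j φ := by
  obtain ⟨d, f, hd, hb, hs, hS, hφ⟩ := H
  exact ⟨d, f, hd, hb, hs, fun i => h (hS i), hφ⟩

theorem IsSpecial.mono {S S' : Set (ι →₀ ℝ)} (h : S ⊆ S') {j d : ℕ} {φ : Fin d → ι →₀ ℝ}
    (H : IsSpecial m n ρ σ S j φ) : IsSpecial m n ρ σ S' j φ := by
  obtain ⟨hb, hS, l, p, hl, h0, hc⟩ := H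
  exact ⟨hb, fun i => h (hS i), l, p, fun i => ⟨(hl i).1, (hl i).2.mono h⟩, h0, hc⟩

/-- The norming set satisfies the closure conditions that define it. -/
theorem isNormingClosed_normingSet :
    IsNormingClosed m n ρ σ (normingSet (ι := ι) m n ρ σ) where
  basis := single_mem m n ρ σ
  neg _ h := neg_mem h
  restrict φ h I hI S hS := hS.restrict φ (h S hS) I hI
  even j hj φ h _ hS := hS.even j hj φ (h.mono (Set.sInter_subset_of_mem hS))
  special j hj d f hd h hsep _ hS :=
    hS.special j hj d f hd (h.mono (Set.sInter_subset_of_mem hS)) hsep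
  convex k f r hf hr hsum S hS := hS.convex k f r (fun i => hf i S hS) hr hsum

open Classical in
/-- The functionals in the norming set all of whose restrictions to intervals are bounded by `8` on
every sum `∑_{k<N} a_k x_k` with `|a_k| ≤ 1`. Restrictions are built into the definition because the
set has to be closed under them. -/
def boundedOn (m n : ℕ → ℕ) (ρ : ι → ι → ℕ) (σ : List (CodeEntry ℕ) → ℕ) (x : ℕ → ι →₀ ℝ) :
    Set (ι →₀ ℝ) :=
  {φ | φ ∈ normingSet m n ρ σ ∧ ∀ I : Set ι, I.OrdConnected → ∀ a : ℕ → ℝ, (∀ k, |a k| ≤ 1) →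
    ∀ N, |pairing (φ.filter (· ∈ I)) (∑ k ∈ Finset.range N, a k • x k)| ≤ 8}

theorem sum_geometric_le_two (s : Finset ℕ) : ∑ k ∈ s, (1 / 2 : ℝ) ^ k ≤ 2 := by
  exact (summable_geometric_two.sum_le_tsum s fun _ _ => by positivity).trans_eq tsum_geometric_two

theorem abs_pairing_sum_le_sum (φ : ι →₀ ℝ) (x : ℕ → ι →₀ ℝ) {a : ℕ → ℝ} (ha : ∀ k, |a k| ≤ 1)
    (s : Finset ℕ) : |pairing φ (∑ k ∈ s, a k • x k)| ≤ ∑ k ∈ s, |pairing φ (x k)| := by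
  rw [pairing_sum_right]
  refine (Finset.abs_sum_le_sum_abs _ _).trans (Finset.sum_le_sum fun k _ => ?_)
  rw [pairing_smul, abs_mul]
  exact mul_le_of_le_one_left (abs_nonneg _) (ha k)

/-- The union of the supports of the first `k` vectors of a sequence. -/
def initSupport (x : ℕ → ι →₀ ℝ) (k : ℕ) : Finset ι :=
  (Finset.range k).biUnion fun l => (x l).support

theorem initSupport_mono (x : ℕ → ι →₀ ℝ) : Monotone (initSupport x) := fun _ _ h =>
  Finset.biUnion_subset_biUnion_of_subset_left _ (Finset.range_mono h)

/-- The crucial step. In a separated sequence `(f_i)`, as soon as two of the `f_i` meet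
`supp x_0 ∪ ⋯ ∪ supp x_k`, the cardinality of all the supports is at most the `ϱ`-number of that
set, so `x_l` is too flat to be noticed for `l > k`. On the vectors before the first such `k` at most
one `f_i` acts, and the factor `1 / M ≤ 1 / 2` absorbs the bound for it. -/
theorem mem_boundedOn_of_isSeparated {x : ℕ → ι →₀ ℝ}
    (hx : ∀ k, ∀ φ ∈ normingSet m n ρ σ, |pairing φ (x k)| ≤ 2)
    (hflat : ∀ k α, |x k α| * (rhoNumber ρ (initSupport x k) + 1) ≤ (1 / 2) ^ k)
    {d : ℕ} {f : Fin d → ι →₀ ℝ} (hsep : IsSeparated ρ f)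
    (hf : ∀ i, f i ∈ boundedOn m n ρ σ x) {M : ℕ} (hM : 2 ≤ M)
    (hφ : (1 / (M : ℝ)) • ∑ i, f i ∈ normingSet m n ρ σ) :
    (1 / (M : ℝ)) • ∑ i, f i ∈ boundedOn m n ρ σ x := by
  classical
  refine ⟨hφ, fun I hI a ha N => ?_⟩
  set φ := (1 / (M : ℝ)) • ∑ i, f i with hφdef
  set ψ := φ.filter (· ∈ I) with hψdef
  have hψK : ψ ∈ normingSet m n ρ σ := by
    convert isNormingClosed_normingSet.restrict φ hφ I hI
  have hψsum : ψ = (1 / (M : ℝ)) • ∑ i, (f i).filter (· ∈ I) := by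
    ext α
    simp only [hψdef, hφdef, Finsupp.filter_apply, Finsupp.smul_apply, Finsupp.finsetSum_apply]
    split_ifs <;> simp
  have hψsupp : ψ.support ⊆ suppUnion f := by
    intro α hα
    by_contra hα'
    have h0 : ∀ i, f i α = 0 := fun i => by
      by_contra h
      exact hα' (Finset.mem_biUnion.2 ⟨i, Finset.mem_univ _, Finsupp.mem_support_iff.2 h⟩)
    refine Finsupp.mem_support_iff.1 hα ?_
    simp [hψdef, hφdef, Finsupp.filter_apply, h0]
  have hMinv : 1 / (M : ℝ) ≤ 1 / 2 :=
    one_div_le_one_div_of_le two_pos (by exact_mod_cast hM)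
  -- `A k` says that at most one of the functionals meets the first `k` vectors.
  let A : ℕ → Prop := fun k => ∀ i j, ¬ Disjoint (f i).support (initSupport x k) →
    ¬ Disjoint (f j).support (initSupport x k) → i = j
  have hhead : ∀ k, A k → |pairing ψ (∑ l ∈ Finset.range k, a l • x l)| ≤ 4 := by
    intro k hk
    have hzero : ∀ i, Disjoint (f i).support (initSupport x k) →
        pairing ((f i).filter (· ∈ I)) (∑ l ∈ Finset.range k, a l • x l) = 0 := by
      intro i hi
      rw [pairing_sum_right]
      refine Finset.sum_eq_zero fun l hl => ?_
      rw [pairing_smul, pairing_eq_zero_of_disjoint, mul_zero]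
      refine hi.mono ?_ (Finset.subset_biUnion_of_mem (fun l => (x l).support) hl)
      rw [Finsupp.support_filter]
      exact Finset.filter_subset _ _
    have h8 : |∑ i, pairing ((f i).filter (· ∈ I)) (∑ l ∈ Finset.range k, a l • x l)| ≤ 8 := by
      by_cases H : ∃ i, ¬ Disjoint (f i).support (initSupport x k)
      · obtain ⟨i, hi⟩ := H
        rw [Finset.sum_eq_single i]
        · convert (hf i).2 I hI a ha k
        · intro j _ hji
          by_contra h
          exact hji (hk j i (fun hd => h (hzero j hd)) hi)
        · simp
      · push Not at H
        rw [Finset.sum_eq_zero fun i _ => hzero i (H i)]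
        norm_num
    rw [hψsum, pairing_smul_left, pairing_sum_left, abs_mul, abs_of_nonneg (by positivity)]
    calc _ ≤ 1 / 2 * (8 : ℝ) := mul_le_mul hMinv h8 (abs_nonneg _) (by norm_num)
      _ = 4 := by norm_num
  by_cases hN : A N
  · exact (hhead N hN).trans (by norm_num)
  -- `k + 1` is the first index where two functionals meet the initial vectors.
  obtain ⟨k, hkN, hAk, hAk1⟩ : ∃ k < N, A k ∧ ¬ A (k + 1) := by
    by_contra! H
    have hall : ∀ k ≤ N, A k := by
      intro k
      induction k with
      | zero => intro _ i j hi; simp [initSupport] at hi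
      | succ k ih => exact fun h => H k h (ih (Nat.le_of_succ_le h))
    exact hN (hall N le_rfl)
  have hcard : (suppUnion f).card ≤ rhoNumber ρ (initSupport x (k + 1)) := by
    simp only [A] at hAk1
    push Not at hAk1
    obtain ⟨i, j, hi, hj, hij⟩ := hAk1
    obtain ⟨α, hα, hα'⟩ := Finset.not_disjoint_iff.1 hi
    obtain ⟨β, hβ, hβ'⟩ := Finset.not_disjoint_iff.1 hj
    exact (hsep i j hij α hα β hβ).trans (le_rhoNumber hα' hβ')
  have htail : |pairing ψ (∑ l ∈ Finset.Ico (k + 1) N, a l • x l)| ≤ 2 := by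
    refine (abs_pairing_sum_le_sum ψ x ha _).trans
      ((Finset.sum_le_sum fun l hl => ?_).trans (sum_geometric_le_two _))
    have hr : (0 : ℝ) < rhoNumber ρ (initSupport x l) + 1 := by positivity
    refine (abs_pairing_le_of_forall_le (abs_le_one_of_mem hψK) hψsupp fun α =>
      (le_div_iff₀ hr).2 (hflat l α)).trans ?_
    have h1 : (suppUnion f).card ≤ rhoNumber ρ (initSupport x l) :=
      hcard.trans (rhoNumber_mono (initSupport_mono x (Finset.mem_Ico.1 hl).1))
    have h2 : ((suppUnion f).card : ℝ) ≤ rhoNumber ρ (initSupport x l) + 1 := by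
      exact_mod_cast h1.trans (Nat.le_succ _)
    rw [mul_div_assoc', div_le_iff₀ hr, mul_comm]
    exact mul_le_mul_of_nonneg_left h2 (by positivity)
  have hmid : |pairing ψ (a k • x k)| ≤ 2 := by
    rw [pairing_smul, abs_mul]
    exact (mul_le_of_le_one_left (abs_nonneg _) (ha k)).trans (hx k ψ hψK)
  rw [← Finset.sum_range_add_sum_Ico _ hkN, Finset.sum_range_succ, pairing_add, pairing_add]
  refine (abs_add_three _ _ _).trans ?_
  linarith [hhead k hAk]

theorem isNormingClosed_boundedOn (hm : StrictMono m) (hm1 : 2 ≤ m 1) {x : ℕ → ι →₀ ℝ}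
    (hx : ∀ k, ∀ φ ∈ normingSet m n ρ σ, |pairing φ (x k)| ≤ 2)
    (hflat : ∀ k α, |x k α| * (rhoNumber ρ (initSupport x k) + 1) ≤ (1 / 2) ^ k) :
    IsNormingClosed m n ρ σ (boundedOn m n ρ σ x) := by
  classical
  have hK := isNormingClosed_normingSet (ι := ι) (m := m) (n := n) (ρ := ρ) (σ := σ)
  have hm2 : ∀ {j}, 1 ≤ j → 2 ≤ m j := fun h => hm1.trans (hm.monotone h)
  refine ⟨fun γ => ⟨hK.basis γ, fun I hI a ha N => ?_⟩, fun φ hφ => ⟨hK.neg φ hφ.1, ?_⟩,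
    fun φ hφ I hI => ⟨hK.restrict φ hφ.1 I hI, ?_⟩, fun j hj φ hφ => ?_,
    fun j hj d f hd hsp hsep => ?_, fun k f r hf hr hsum =>
      ⟨hK.convex k f r (fun i => (hf i).1) hr hsum, ?_⟩⟩
  · have hγ : ∀ k, |pairing ((Finsupp.single γ (1 : ℝ)).filter (· ∈ I)) (x k)| ≤ (1 / 2) ^ k := by
      intro k
      by_cases h : γ ∈ I
      · rw [Finsupp.filter_single_of_pos _ h, pairing_single]
        refine le_trans ?_ (hflat k γ)
        exact le_mul_of_one_le_right (abs_nonneg _) (by simp)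
      · rw [Finsupp.filter_single_of_neg _ h]
        simp [pairing]
    refine (abs_pairing_sum_le_sum _ x ha _).trans
      ((Finset.sum_le_sum fun k _ => hγ k).trans ((sum_geometric_le_two _).trans (by norm_num)))
  · intro I hI a ha N
    have h : (-φ).filter (· ∈ I) = -(φ.filter (· ∈ I)) := by
      ext α
      simp only [Finsupp.filter_apply, Finsupp.neg_apply]
      split_ifs <;> simp
    rw [h, pairing_neg_left, abs_neg]
    exact hφ.2 I hI a ha N
  · intro J hJ a ha N
    have h : (φ.filter (· ∈ I)).filter (· ∈ J) = φ.filter (· ∈ I ∩ J) := by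
      ext α
      simp only [Finsupp.filter_apply, Set.mem_inter_iff]
      split_ifs <;> simp_all
    rw [h]
    convert hφ.2 _ (hI.inter hJ) a ha N
  · have hφK := hK.even j hj φ (hφ.mono fun _ h => h.1)
    obtain ⟨d, f, -, -, hsep, hf, rfl⟩ := hφ
    exact mem_boundedOn_of_isSeparated hx hflat hsep hf (hm2 (by omega)) hφK
  · exact mem_boundedOn_of_isSeparated hx hflat hsep hsp.2.1 (hm2 (by omega))
      (hK.special j hj d f hd (hsp.mono fun _ h => h.1) hsep)
  · intro I hI a ha N
    have h : (∑ i, (r i : ℝ) • f i).filter (· ∈ I) =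
        ∑ i, (r i : ℝ) • (f i).filter (· ∈ I) := by
      ext α
      simp only [Finsupp.filter_apply, Finsupp.smul_apply, Finsupp.finsetSum_apply]
      split_ifs <;> simp
    have hsum' : ∑ i, (r i : ℝ) * 8 = 8 := by
      rw [← Finset.sum_mul, show ∑ i, (r i : ℝ) = 1 by exact_mod_cast hsum, one_mul]
    rw [h, pairing_sum_left, ← hsum']
    refine (Finset.abs_sum_le_sum_abs _ _).trans (Finset.sum_le_sum fun i _ => ?_)
    have h0 : (0 : ℝ) ≤ r i := by exact_mod_cast hr i
    rw [pairing_smul_left, abs_mul, abs_of_nonneg h0]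
    exact mul_le_mul_of_nonneg_left ((hf i).2 I hI a ha N) h0

/-- Vectors whose coordinates are small compared with the `ϱ`-number of the preceding supports
satisfy an upper `c₀`-estimate. -/
theorem abs_pairing_sum_le_of_flat (hm : StrictMono m) (hm1 : 2 ≤ m 1) {x : ℕ → ι →₀ ℝ}
    (hx : ∀ k, ∀ φ ∈ normingSet m n ρ σ, |pairing φ (x k)| ≤ 2)
    (hflat : ∀ k α, |x k α| * (rhoNumber ρ (initSupport x k) + 1) ≤ (1 / 2) ^ k)
    {φ : ι →₀ ℝ} (hφ : φ ∈ normingSet m n ρ σ) {a : ℕ → ℝ} (ha : ∀ k, |a k| ≤ 1) (N : ℕ) :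
    |pairing φ (∑ k ∈ Finset.range N, a k • x k)| ≤ 8 := by
  classical
  have h := (hφ _ (isNormingClosed_boundedOn hm hm1 hx hflat)).2 Set.univ Set.ordConnected_univ
    a ha N
  convert h
  ext α
  simp

end Norming

/-! ### Coordinates on the completion and saturation -/

section Saturation

variable {m n : ℕ → ℕ} {ρ : Omega1 → Omega1 → ℕ} {σ : List (CodeEntry ℕ) → ℕ}

variable (m n ρ σ) in
/-- The inclusion of `c₀₀(ω₁)` into its completion. -/
def incl : (Omega1 →₀ ℝ) →ₗ[ℝ] SpaceX m n ρ σ :=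
  (UniformSpace.Completion.toComplL (𝕜 := ℝ) (E := PreSpace m n ρ σ)).toLinearMap ∘ₗ
    (toC00 (m := m) (n := n) (ρ := ρ) (σ := σ)).symm.toLinearMap

theorem incl_eq_coe (x : Omega1 →₀ ℝ) :
    incl m n ρ σ x = ((toC00.symm x : PreSpace m n ρ σ) : SpaceX m n ρ σ) := rfl

theorem norm_incl (x : Omega1 →₀ ℝ) :
    ‖incl m n ρ σ x‖ = ‖(toC00.symm x : PreSpace m n ρ σ)‖ := by
  rw [incl_eq_coe, UniformSpace.Completion.norm_coe]

theorem exists_norm_sub_incl_le (y : SpaceX m n ρ σ) {ε : ℝ} (hε : 0 < ε) :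
    ∃ x, ‖y - incl m n ρ σ x‖ ≤ ε := by
  obtain ⟨z, hz⟩ := UniformSpace.Completion.denseRange_coe.exists_dist_lt y hε
  refine ⟨toC00 z, ?_⟩
  rw [incl_eq_coe, LinearEquiv.symm_apply_apply, ← dist_eq_norm]
  exact hz.le

variable (m n ρ σ) in
/-- The coordinate functional `e_γ^*`, extended to the completion. -/
def coordFunctional (γ : Omega1) : StrongDual ℝ (SpaceX m n ρ σ) :=
  (LinearMap.mkContinuous (Finsupp.lapply γ ∘ₗ
    (toC00 (m := m) (n := n) (ρ := ρ) (σ := σ)).toLinearMap) 1 fun x => by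
      rw [one_mul]
      exact abs_apply_le_norm x γ).extend UniformSpace.Completion.toComplL

theorem coordFunctional_incl (γ : Omega1) (x : Omega1 →₀ ℝ) :
    coordFunctional m n ρ σ γ (incl m n ρ σ x) = x γ :=
  ContinuousLinearMap.extend_eq _ UniformSpace.Completion.denseRange_coe
    (UniformSpace.Completion.isUniformInducing_coe _) _

theorem abs_coordFunctional_le (γ : Omega1) (y : SpaceX m n ρ σ) :
    |coordFunctional m n ρ σ γ y| ≤ ‖y‖ := by
  induction y using UniformSpace.Completion.induction_on with
  | hp => exact isClosed_le (coordFunctional m n ρ σ γ).continuous.abs continuous_norm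
  | ih x =>
    have h := coordFunctional_incl (m := m) (n := n) (ρ := ρ) (σ := σ) γ (toC00 x)
    rw [incl_eq_coe, LinearEquiv.symm_apply_apply] at h
    rw [h, UniformSpace.Completion.norm_coe]
    exact abs_apply_le_norm x γ

theorem initSupport_eq_biUnion_fin (x : ℕ → Omega1 →₀ ℝ) (k : ℕ) :
    initSupport x k = Finset.univ.biUnion fun i : Fin k => (x i).support := by
  ext α
  simp [initSupport, Fin.exists_iff]

variable (m n ρ σ) in
/-- `y` and `x` are terms of a perturbed flat sequence: `y` is the term with index `k`, the vector
`x ∈ c₀₀(ω₁)` is close to it, and the coordinates of `x` are small compared with the `ϱ`-number of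
the set `F` of the preceding supports. -/
structure IsFlatApprox (F : Finset Omega1) (k : ℕ) (y : SpaceX m n ρ σ) (x : Omega1 →₀ ℝ) :
    Prop where
  close : ‖y - incl m n ρ σ x‖ ≤ (1 / 2) ^ k
  flat : ∀ α, |x α| * (rhoNumber ρ F + 1) ≤ (1 / 2) ^ k

/-- A vector with sufficiently small coordinates has a finitely supported approximation of the
required flatness: the coordinates are dominated by the norm, so a good approximation in norm also
has small coordinates. -/
theorem exists_isFlatApprox (F : Finset Omega1) (k : ℕ) : ∃ ε > 0, ∀ y : SpaceX m n ρ σ,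
    (∀ γ, |coordFunctional m n ρ σ γ y| ≤ ε) → ∃ x, IsFlatApprox m n ρ σ F k y x := by
  have hr : (1 : ℝ) ≤ rhoNumber ρ F + 1 := by simp
  refine ⟨(1 / 2) ^ k / (2 * (rhoNumber ρ F + 1)), by positivity, fun y hy => ?_⟩
  obtain ⟨x, hx⟩ := exists_norm_sub_incl_le y
    (ε := (1 / 2) ^ k / (2 * (rhoNumber ρ F + 1))) (by positivity)
  refine ⟨x, hx.trans (div_le_self (by positivity) (by linarith)), fun α => ?_⟩
  have h1 := (abs_coordFunctional_le α (y - incl m n ρ σ x)).trans hx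
  rw [map_sub, coordFunctional_incl] at h1
  have h2 : |x α| ≤ (1 / 2) ^ k / (rhoNumber ρ F + 1) := by
    calc |x α| = |coordFunctional m n ρ σ α y - (coordFunctional m n ρ σ α y - x α)| := by
          rw [sub_sub_cancel]
      _ ≤ (1 / 2) ^ k / (2 * (rhoNumber ρ F + 1)) + (1 / 2) ^ k / (2 * (rhoNumber ρ F + 1)) :=
          (abs_sub _ _).trans (add_le_add (hy α) h1)
      _ = (1 / 2) ^ k / (rhoNumber ρ F + 1) := by field_simp; norm_num
  exact (le_div_iff₀ (by linarith)).1 h2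

/-- Since the errors `‖y_k - x_k‖` are summable, the upper `c₀`-estimate passes from the flat vectors
`x_k` to their perturbations `y_k`. -/
theorem norm_sum_le_of_isFlatApprox (hm : StrictMono m) (hm1 : 2 ≤ m 1)
    {y : ℕ → SpaceX m n ρ σ} {x : ℕ → Omega1 →₀ ℝ} (hy : ∀ k, ‖y k‖ = 1)
    (h : ∀ k, IsFlatApprox m n ρ σ (initSupport x k) k (y k) (x k))
    {a : ℕ → ℝ} (ha : ∀ k, |a k| ≤ 1) (N : ℕ) : ‖∑ k ∈ Finset.range N, a k • y k‖ ≤ 10 := by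
  have hx : ∀ k, ∀ φ ∈ normingSet m n ρ σ, |pairing φ (x k)| ≤ 2 := by
    intro k φ hφ
    refine (abs_pairing_le_norm (toC00.symm (x k) : PreSpace m n ρ σ) hφ).trans ?_
    rw [← norm_incl]
    have h1 : ‖incl m n ρ σ (x k)‖ ≤ ‖y k‖ + ‖y k - incl m n ρ σ (x k)‖ := by
      simpa using norm_sub_le (y k) (y k - incl m n ρ σ (x k))
    have h2 : (1 / 2 : ℝ) ^ k ≤ 1 := pow_le_one₀ (by norm_num) (by norm_num)
    linarith [(h k).close, hy k]
  have hsum : ‖incl m n ρ σ (∑ k ∈ Finset.range N, a k • x k)‖ ≤ 8 := by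
    rw [norm_incl]
    exact norm_le_of fun φ hφ => (le_abs_self _).trans
      (abs_pairing_sum_le_of_flat hm hm1 hx (fun k => (h k).flat) hφ ha N)
  have hdiff : ‖∑ k ∈ Finset.range N, a k • (y k - incl m n ρ σ (x k))‖ ≤ 2 := by
    refine (norm_sum_le _ _).trans ((Finset.sum_le_sum fun k _ => ?_).trans
      (sum_geometric_le_two (Finset.range N)))
    rw [norm_smul, Real.norm_eq_abs]
    exact (mul_le_of_le_one_left (norm_nonneg _) (ha k)).trans (h k).close
  have heq : ∑ k ∈ Finset.range N, a k • y k =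
      incl m n ρ σ (∑ k ∈ Finset.range N, a k • x k) +
        ∑ k ∈ Finset.range N, a k • (y k - incl m n ρ σ (x k)) := by
    simp [smul_sub, map_sum]
  rw [heq]
  exact (norm_add_le _ _).trans (by linarith)

/-- A gliding hump: if each `y_k` is close to `x_k ∈ c₀₀(ω₁)` and vanishes on the supports of the
preceding `x_l`, then at each coordinate at most one `y_k` is not small. -/
theorem abs_coordFunctional_sum_le {y : ℕ → SpaceX m n ρ σ} {x : ℕ → Omega1 →₀ ℝ}
    (hy : ∀ k, ‖y k‖ = 1) (hyx : ∀ k, ‖y k - incl m n ρ σ (x k)‖ ≤ (1 / 2) ^ k)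
    (hzero : ∀ k, ∀ γ ∈ initSupport x k, coordFunctional m n ρ σ γ (y k) = 0)
    {a : ℕ → ℝ} (ha : ∀ k, |a k| ≤ 1) (N : ℕ) (γ : Omega1) :
    |coordFunctional m n ρ σ γ (∑ k ∈ Finset.range N, a k • y k)| ≤ 3 := by
  have hsmall : ∀ k, γ ∉ (x k).support → |coordFunctional m n ρ σ γ (y k)| ≤ (1 / 2) ^ k := by
    intro k hk
    have h := (abs_coordFunctional_le γ (y k - incl m n ρ σ (x k))).trans (hyx k)
    rwa [map_sub, coordFunctional_incl, Finsupp.notMem_support_iff.1 hk, sub_zero] at h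
  obtain ⟨k₀, hk₀⟩ : ∃ k₀, ∀ k, |coordFunctional m n ρ σ γ (y k)| ≤
      (1 / 2) ^ k + if k = k₀ then 1 else 0 := by
    by_cases H : ∃ k, γ ∈ (x k).support
    · classical
      refine ⟨Nat.find H, fun k => ?_⟩
      rcases lt_trichotomy k (Nat.find H) with hk | rfl | hk
      · rw [if_neg hk.ne, add_zero]
        exact hsmall k (Nat.find_min H hk)
      · have h := abs_coordFunctional_le γ (y (Nat.find H))
        have hp : (0 : ℝ) ≤ (1 / 2) ^ Nat.find H := by positivity
        rw [hy] at h
        rw [if_pos rfl]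
        linarith
      · rw [hzero k γ (Finset.mem_biUnion.2 ⟨_, Finset.mem_range.2 hk, Nat.find_spec H⟩),
          if_neg hk.ne', abs_zero]
        positivity
    · push Not at H
      refine ⟨0, fun k => (hsmall k (H k)).trans ?_⟩
      split_ifs <;> simp
  rw [map_sum]
  refine (Finset.abs_sum_le_sum_abs _ _).trans ?_
  calc ∑ k ∈ Finset.range N, |coordFunctional m n ρ σ γ (a k • y k)|
      ≤ ∑ k ∈ Finset.range N, ((1 / 2) ^ k + if k = k₀ then 1 else 0) := by
        refine Finset.sum_le_sum fun k _ => ?_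
        rw [map_smul, smul_eq_mul, abs_mul]
        exact (mul_le_of_le_one_left (abs_nonneg _) (ha k)).trans (hk₀ k)
    _ ≤ 2 + 1 := by
        rw [Finset.sum_add_distrib]
        refine add_le_add (sum_geometric_le_two _) ?_
        rw [Finset.sum_ite_eq']
        split_ifs <;> norm_num
    _ = 3 := by norm_num

/-- If the norm is equivalent to the supremum of the coordinates on a subspace of finite codimension
in `Y`, then `Y` contains `c₀`, by a gliding hump argument. -/
theorem exists_equiv_c0_of_norm_le_coord {Y : Submodule ℝ (SpaceX m n ρ σ)}
    (hY : IsClosed (Y : Set (SpaceX m n ρ σ))) (hdim : ¬ FiniteDimensional ℝ Y)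
    (Φ : Finset (StrongDual ℝ (SpaceX m n ρ σ))) (C : ℝ)
    (hC : ∀ y ∈ Y, (∀ f ∈ Φ, f y = 0) → ∀ B, (∀ γ, |coordFunctional m n ρ σ γ y| ≤ B) →
      ‖y‖ ≤ C * B) :
    ∃ Z : Submodule ℝ (SpaceX m n ρ σ), Z ≤ Y ∧ Nonempty (C₀(ℕ, ℝ) ≃L[ℝ] Z) := by
  classical
  obtain ⟨u, hu, hnorm, hlower⟩ := exists_seq_abs_le_norm_sum
    (α := SpaceX m n ρ σ × (Omega1 →₀ ℝ)) Prod.fst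
    (fun k g b => b.1 ∈ Y ∧ (∀ f ∈ Φ, f b.1 = 0) ∧
      (∀ γ ∈ Finset.univ.biUnion fun i => (g i).2.support, coordFunctional m n ρ σ γ b.1 = 0) ∧
      ‖b.1 - incl m n ρ σ b.2‖ ≤ (1 / 2) ^ k) (by
    intro k g Ψ
    obtain ⟨y, hyY, hy1, hy⟩ := exists_unit_vector_mem_ker hdim (Ψ ∪ (Φ ∪
      (Finset.univ.biUnion fun i => (g i).2.support).image (coordFunctional m n ρ σ)))
    obtain ⟨x, hx⟩ := exists_norm_sub_incl_le y (ε := (1 / 2) ^ k) (by positivity)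
    refine ⟨(y, x), ⟨hyY, fun f hf => hy f ?_, fun γ hγ => hy _ ?_, hx⟩, hy1, fun f hf => hy f ?_⟩
    · exact Finset.mem_union_right _ (Finset.mem_union_left _ hf)
    · exact Finset.mem_union_right _ (Finset.mem_union_right _ (Finset.mem_image_of_mem _ hγ))
    · exact Finset.mem_union_left _ hf)
  refine exists_submodule_equiv_c0 hY (fun k => (hu k).1) (C := C * 3) (fun a ha N => ?_) hlower
  refine hC _ (Y.sum_mem fun k _ => Y.smul_mem _ (hu k).1) (fun f hf => ?_) _ fun γ =>
    abs_coordFunctional_sum_le (x := fun k => (u k).2) hnorm (fun k => (hu k).2.2.2)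
      (fun k γ hγ => (hu k).2.2.1 γ ?_) ha N γ
  · rw [map_sum]
    exact Finset.sum_eq_zero fun k _ => by rw [map_smul, (hu k).2.1 f hf, smul_zero]
  · rwa [initSupport_eq_biUnion_fin] at hγ

/-- If every subspace of finite codimension in `Y` has unit vectors with arbitrarily small
coordinates, then `Y` contains `c₀`, by the upper estimate for flat sequences. -/
theorem exists_equiv_c0_of_small_coord (hm : StrictMono m) (hm1 : 2 ≤ m 1)
    {Y : Submodule ℝ (SpaceX m n ρ σ)} (hY : IsClosed (Y : Set (SpaceX m n ρ σ)))
    (h : ∀ (Ψ : Finset (StrongDual ℝ (SpaceX m n ρ σ))), ∀ ε > 0, ∃ y ∈ Y, ‖y‖ = 1 ∧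
      (∀ f ∈ Ψ, f y = 0) ∧ ∀ γ, |coordFunctional m n ρ σ γ y| ≤ ε) :
    ∃ Z : Submodule ℝ (SpaceX m n ρ σ), Z ≤ Y ∧ Nonempty (C₀(ℕ, ℝ) ≃L[ℝ] Z) := by
  obtain ⟨u, hu, hnorm, hlower⟩ := exists_seq_abs_le_norm_sum
    (α := SpaceX m n ρ σ × (Omega1 →₀ ℝ)) Prod.fst
    (fun k g b => b.1 ∈ Y ∧
      IsFlatApprox m n ρ σ (Finset.univ.biUnion fun i => (g i).2.support) k b.1 b.2) (by
    intro k g Ψ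
    obtain ⟨ε, hε, happrox⟩ := exists_isFlatApprox (m := m) (n := n) (ρ := ρ) (σ := σ)
      (Finset.univ.biUnion fun i => (g i).2.support) k
    obtain ⟨y, hyY, hy1, hyΨ, hyε⟩ := h Ψ ε hε
    obtain ⟨x, hx⟩ := happrox y hyε
    exact ⟨(y, x), ⟨hyY, hx⟩, hy1, hyΨ⟩)
  refine exists_submodule_equiv_c0 hY (fun k => (hu k).1) (fun a ha N =>
    norm_sum_le_of_isFlatApprox hm hm1 (x := fun k => (u k).2) hnorm (fun k => ?_) ha N) hlower
  rw [initSupport_eq_biUnion_fin]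
  exact (hu k).2

end Saturation

end C0Sat

end

theorem mainTheorem4 (m n : ℕ → ℕ) (hm : StrictMono m) (hm1 : 2 ≤ m 1) (hn : StrictMono n)
    (ρ : C0Sat.Omega1 → C0Sat.Omega1 → ℕ) (hρ : C0Sat.IsRhoFunction ρ)
    (σ : List (C0Sat.CodeEntry ℕ) → ℕ) (hσ : C0Sat.IsCoding σ) :
    C0Sat.IsC0Saturated (C0Sat.SpaceX m n ρ σ) := by
  intro Y hY hdim
  by_cases H : ∃ (Φ : Finset (StrongDual ℝ (C0Sat.SpaceX m n ρ σ))) (C : ℝ),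
      ∀ y ∈ Y, (∀ f ∈ Φ, f y = 0) → ∀ B, (∀ γ, |C0Sat.coordFunctional m n ρ σ γ y| ≤ B) →
        ‖y‖ ≤ C * B
  · obtain ⟨Φ, C, hC⟩ := H
    exact C0Sat.exists_equiv_c0_of_norm_le_coord hY hdim Φ C hC
  · push Not at H
    refine C0Sat.exists_equiv_c0_of_small_coord hm hm1 hY fun Ψ ε hε => ?_
    obtain ⟨y, hyY, hyΨ, B, hB, hlt⟩ := H Ψ ε⁻¹
    obtain ⟨γ₀⟩ := C0Sat.exists_index
    have hB0 : 0 ≤ B := (abs_nonneg _).trans (hB γ₀)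
    have hy : 0 < ‖y‖ := lt_of_le_of_lt (by positivity) hlt
    refine ⟨‖y‖⁻¹ • y, Y.smul_mem _ hyY, ?_, fun f hf => ?_, fun γ => ?_⟩
    · rw [norm_smul, norm_inv, norm_norm, inv_mul_cancel₀ hy.ne']
    · rw [map_smul, hyΨ f hf, smul_zero]
    · rw [map_smul, smul_eq_mul, abs_mul, abs_inv, abs_norm, inv_mul_le_iff₀ hy]
      rw [inv_mul_lt_iff₀ hε] at hlt
      exact (hB γ).trans (by linarith)
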